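/- Let $\mathcal M$ be a connected affine manifold of dimension $n$, i.e. a manifold with an atlas whose coordinate changes are (locally) affine maps of $\mathbb R^n$, and let $\nabla$ be the connection on $T\mathcal M$ that in every affine chart $\varphi$ is the pullback $\varphi^\star\nabla^{\mathrm{euc}}$ of the standard connection of $\mathbb R^n$. Let $\pi:\tilde{\mathcal M}\to\mathcal M$ be the universal cover (a simply connected covering manifold, with $\pi$ a local diffeomorphism), equipped with the pullback connection $\tilde\nabla=\pi^\star\nabla$. Let $\tilde\Pi_q^{q'}:T_q\tilde{\mathcal M}\to T_{q'}\tilde{\mathcal M}$ denote parallel transport with respect to $\tilde\nabla$; it does not depend on the ($C^1$) curve from $q$ to $q'$. Fix $p\in\tilde{\mathcal M}$ and let $$\operatorname{dev}:\tilde{\mathcal M}\to T_p\tilde{\mathcal M},\qquad \operatorname{dev}(q)=\int_0^1\tilde\Pi_{\gamma(t)}^{p}(\dot\gamma(t))\,dt ,$$ where $\gamma:[0,1]\to\tilde{\mathcal M}$ is any $C^1$ curve from $p$ to $q$; such a curve exists and the integral does not depend on it. Let $\operatorname{deck}(\tilde{\mathcal M})$ be the group, under composition, of homeomorphisms $\varphi:\tilde{\mathcal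 M}\to\tilde{\mathcal M}$ with $\pi\circ\varphi=\pi$; these are smooth. For $\varphi\in\operatorname{deck}(\tilde{\mathcal M})$ put $$m_\varphi(v)=A_\varphi v+b_\varphi,\qquad A_\varphi=\tilde\Pi_{\varphi(p)}^{p}\circ d\varphi_p,\qquad b_\varphi=\operatorname{dev}(\varphi(p)),$$ so that $\operatorname{dev}(\varphi(q))=m_\varphi(\operatorname{dev}(q))$ for all $q\in\tilde{\mathcal M}$. Then $\varphi\mapsto m_\varphi$ is a group homomorphism from $\operatorname{deck}(\tilde{\mathcal M})$ to the group of (invertible) affine transformations of $T_p\tilde{\mathcal M}$: for all $\varphi,\psi\in\operatorname{deck}(\tilde{\mathcal M})$, $$m_{\varphi\circ\psi}=m_\varphi\circ m_\psi ,$$ and, equivalently, $A_{\varphi\circ\psi}=A_\varphi A_\psi$ and $b_{\varphi\circ\psi}=A_\varphi b_\psi+b_\varphi$. -/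

import Mathlib

open Set VectorField
open scoped Manifold ContDiff Topology

noncomputable section

namespace AffineMonodromy

section AffineManifold

variable (E : Type*) [NormedAddCommGroup E] [NormedSpace ℝ E]

/-- The pregroupoid of locally affine maps between open subsets of `E`. -/
def affinePregroupoid : Pregroupoid E where
  property f s := ∀ x ∈ s, ∃ u, IsOpen u ∧ x ∈ u ∧ ∃ A : E →ᴬ[ℝ] E, EqOn f A (s ∩ u)
  comp {f g u v} hf hg _ _ huv := by
    intro x hx
    obtain ⟨a, ha, hxa, A, hA⟩ := hf x hx.1
    obtain ⟨b, hb, hxb, B, hB⟩ := hg (f x) hx.2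
    refine ⟨a ∩ A ⁻¹' b, ha.inter (hb.preimage A.continuous), ⟨hxa, ?_⟩, B.comp A, ?_⟩
    · rw [mem_preimage, ← hA ⟨hx.1, hxa⟩]; exact hxb
    · rintro y ⟨⟨hyu, hyv⟩, hya, hyb⟩
      have h1 : f y = A y := hA ⟨hyu, hya⟩
      have h2 : g (f y) = B (f y) := hB ⟨hyv, by rw [h1]; exact hyb⟩
      rw [Function.comp_apply, h2, h1]; rfl
  id_mem x _ := ⟨univ, isOpen_univ, mem_univ x, ContinuousAffineMap.id ℝ E, fun _ _ => rfl⟩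
  locality {f u} _ h x hx := by
    obtain ⟨v, hv, hxv, hp⟩ := h x hx
    obtain ⟨w, hw, hxw, A, hA⟩ := hp x ⟨hx, hxv⟩
    exact ⟨v ∩ w, hv.inter hw, ⟨hxv, hxw⟩, A, fun y hy => hA ⟨⟨hy.1, hy.2.1⟩, hy.2.2⟩⟩
  congr {f g u} _ hfg h x hx := by
    obtain ⟨w, hw, hxw, A, hA⟩ := h x hx
    exact ⟨w, hw, hxw, A, fun y hy => by rw [hfg y hy.1]; exact hA hy⟩

/-- The structure groupoid of locally affine homeomorphisms between open subsets of `E`. An affine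
manifold modelled on `E` is a charted space `M` with `[HasGroupoid M (affineGroupoid E)]`, i.e. all
its coordinate changes are (locally) affine. -/
def affineGroupoid : StructureGroupoid E := (affinePregroupoid E).groupoid

variable {E}

theorem affineGroupoid_le : affineGroupoid E ≤ contDiffGroupoid ∞ 𝓘(ℝ, E) := by
  refine groupoid_of_pregroupoid_le _ _ ?_
  intro f s hf
  have : ContDiffOn ℝ ∞ f s := by
    intro x hx
    obtain ⟨u, hu, hxu, A, hA⟩ := hf x hx
    refine (A.contDiff.contDiffWithinAt (s := s)).congr_of_eventuallyEq ?_ (hA ⟨hx, hxu⟩)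
    filter_upwards [inter_mem_nhdsWithin s (hu.mem_nhds hxu)] with y hy using hA hy
  simpa [contDiffPregroupoid] using this

/-- An affine manifold is a smooth manifold. -/
instance {M : Type*} [TopologicalSpace M] [ChartedSpace E M] [HasGroupoid M (affineGroupoid E)] :
    IsManifold 𝓘(ℝ, E) ∞ M :=
  have := hasGroupoid_of_le (M := M) ‹_› (affineGroupoid_le (E := E))
  IsManifold.mk' _ _ _

end AffineManifold

section Connections

variable {E : Type*} [NormedAddCommGroup E] [NormedSpace ℝ E]

/-- Connections on the tangent bundle of a manifold `N` modelled on `E`; the value `∇ Y x v` is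
the covariant derivative `(∇_v Y)(x)`. -/
abbrev Connection (E : Type*) [NormedAddCommGroup E] [NormedSpace ℝ E]
    (N : Type*) [TopologicalSpace N] [ChartedSpace E N] [IsManifold 𝓘(ℝ, E) 1 N] :=
  CovariantDerivative 𝓘(ℝ, E) E (fun x : N => TangentSpace 𝓘(ℝ, E) x)

theorem differentiableAt_of_vectorField {Y : Π x : E, TangentSpace 𝓘(ℝ, E) x} {x : E}
    (h : MDiffAt (T% Y) x) : DifferentiableAt ℝ (Y : E → E) x :=
  mdifferentiableAt_iff_differentiableAt.1 <|
    ((contMDiff_snd_tangentBundle_modelSpace (n := 1) E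
      𝓘(ℝ, E)).contMDiffAt.mdifferentiableAt one_ne_zero).comp x h

/-- The standard connection of the vector space `E`: `∇_v Y` is the directional derivative. -/
def euclideanConnection (E : Type*) [NormedAddCommGroup E] [NormedSpace ℝ E] : Connection E E where
  toFun Y x := fderiv ℝ (Y : E → E) x
  isCovariantDerivativeOnUniv :=
    { add := by
        intro Y Z x hY hZ _
        have key : ∀ Y Z : E → E, DifferentiableAt ℝ Y x → DifferentiableAt ℝ Z x →
          fderiv ℝ (Y + Z) x = fderiv ℝ Y x + fderiv ℝ Z x := fun _ _ => fderiv_add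
        exact key Y Z (differentiableAt_of_vectorField hY) (differentiableAt_of_vectorField hZ)
      leibniz := by
        intro Y h x hY hh _
        refine (fderiv_smul (mdifferentiableAt_iff_differentiableAt.1 hh)
          (differentiableAt_of_vectorField hY)).trans ?_
        rw [mvfderiv, mfderiv_eq_fderiv]
        rfl }

variable {N M : Type*} [TopologicalSpace N] [ChartedSpace E N]
  [TopologicalSpace M] [ChartedSpace E M]

/-- The value at `x` of the pullback connection `(X, Y) ↦ df⁻¹ (∇_{df X} (df Y))`, for a map `f`
with smooth local inverse `g` near `x`. Here `df Y` is the vector field `y ↦ (dg_y)⁻¹ (Y (g y))`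
defined near `f x`. -/
def pullbackAt [IsManifold 𝓘(ℝ, E) 1 M] (f : N → M) (g : M → N) (D : Connection E M)
    (Y : Π x : N, TangentSpace 𝓘(ℝ, E) x) (x : N) :
    TangentSpace 𝓘(ℝ, E) x →L[ℝ] TangentSpace 𝓘(ℝ, E) x :=
  (mfderiv 𝓘(ℝ, E) 𝓘(ℝ, E) f x).inverse ∘L
    (D (mpullback 𝓘(ℝ, E) 𝓘(ℝ, E) g Y) (f x)) ∘L (mfderiv 𝓘(ℝ, E) 𝓘(ℝ, E) f x)

section PullbackLaws

variable {f : N → M} {g : M → N} {x : N}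

theorem mfderiv_comp_eq_id (hf : ContMDiffAt 𝓘(ℝ, E) 𝓘(ℝ, E) ∞ f x)
    (hg : ContMDiffAt 𝓘(ℝ, E) 𝓘(ℝ, E) ∞ g (f x)) (hgf : ∀ᶠ y in 𝓝 x, g (f y) = y) :
    (mfderiv 𝓘(ℝ, E) 𝓘(ℝ, E) g (f x)) ∘L (mfderiv 𝓘(ℝ, E) 𝓘(ℝ, E) f x) =
      (ContinuousLinearMap.id ℝ E : E →L[ℝ] E) := by
  have h1 := mfderiv_comp x (hg.mdifferentiableAt (by simp)) (hf.mdifferentiableAt (by simp))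
  have h2 : g ∘ f =ᶠ[𝓝 x] id := hgf
  rw [h2.mfderiv_eq, mfderiv_id] at h1
  exact h1.symm

theorem isInvertible_mfderiv (hf : ContMDiffAt 𝓘(ℝ, E) 𝓘(ℝ, E) ∞ f x)
    (hg : ContMDiffAt 𝓘(ℝ, E) 𝓘(ℝ, E) ∞ g (f x)) (hgf : ∀ᶠ y in 𝓝 x, g (f y) = y)
    (hfg : ∀ᶠ y in 𝓝 (f x), f (g y) = y) :
    (mfderiv 𝓘(ℝ, E) 𝓘(ℝ, E) f x).IsInvertible ∧
      (mfderiv 𝓘(ℝ, E) 𝓘(ℝ, E) g (f x)).IsInvertible := by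
  have hx : g (f x) = x := hgf.self_of_nhds
  have h1 := mfderiv_comp_eq_id hf hg hgf
  have h2 := mfderiv_comp_eq_id (f := g) (g := f) hg (by rw [hx]; exact hf) hfg
  rw [hx] at h2
  exact ⟨.of_inverse (g := mfderiv 𝓘(ℝ, E) 𝓘(ℝ, E) g (f x)) h2 h1,
    .of_inverse (g := mfderiv 𝓘(ℝ, E) 𝓘(ℝ, E) f x) h1 h2⟩

variable [CompleteSpace E] [IsManifold 𝓘(ℝ, E) ∞ M] [IsManifold 𝓘(ℝ, E) ∞ N]

theorem pullbackAt_add (D : Connection E M) (hf : ContMDiffAt 𝓘(ℝ, E) 𝓘(ℝ, E) ∞ f x)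
    (hg : ContMDiffAt 𝓘(ℝ, E) 𝓘(ℝ, E) ∞ g (f x)) (hgf : ∀ᶠ y in 𝓝 x, g (f y) = y)
    (hfg : ∀ᶠ y in 𝓝 (f x), f (g y) = y) {Y Z : Π x : N, TangentSpace 𝓘(ℝ, E) x}
    (hY : MDiffAt (T% Y) x) (hZ : MDiffAt (T% Z) x) :
    pullbackAt f g D (Y + Z) x = pullbackAt f g D Y x + pullbackAt f g D Z x := by
  have hx : g (f x) = x := hgf.self_of_nhds
  have hi := (isInvertible_mfderiv hf hg hgf hfg).2
  have hY' := MDifferentiableAt.mpullback_vectorField (x₀ := f x) (f := g) (V := Y) (n := 2)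
    (by rw [hx]; exact hY) (hg.of_le ENat.LEInfty.out) hi le_rfl
  have hZ' := MDifferentiableAt.mpullback_vectorField (x₀ := f x) (f := g) (V := Z) (n := 2)
    (by rw [hx]; exact hZ) (hg.of_le ENat.LEInfty.out) hi le_rfl
  have := D.isCovariantDerivativeOnUniv.add hY' hZ'
  simp only [pullbackAt]
  rw [mpullback_add, this]
  simp

theorem pullbackAt_leibniz (D : Connection E M) (hf : ContMDiffAt 𝓘(ℝ, E) 𝓘(ℝ, E) ∞ f x)
    (hg : ContMDiffAt 𝓘(ℝ, E) 𝓘(ℝ, E) ∞ g (f x)) (hgf : ∀ᶠ y in 𝓝 x, g (f y) = y)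
    (hfg : ∀ᶠ y in 𝓝 (f x), f (g y) = y) {Y : Π x : N, TangentSpace 𝓘(ℝ, E) x} {h : N → ℝ}
    (hY : MDiffAt (T% Y) x) (hh : MDiffAt h x) :
    pullbackAt f g D (h • Y) x = h x • pullbackAt f g D Y x + (d% h x).smulRight (Y x) := by
  have hx : g (f x) = x := hgf.self_of_nhds
  obtain ⟨hi', hi⟩ := isInvertible_mfderiv hf hg hgf hfg
  have hY' := MDifferentiableAt.mpullback_vectorField (x₀ := f x) (f := g) (V := Y) (n := 2)
    (by rw [hx]; exact hY) (hg.of_le ENat.LEInfty.out) hi le_rfl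
  have hgd := hg.mdifferentiableAt (by simp)
  have hhd : MDiffAt h (g (f x)) := by rw [hx]; exact hh
  have := D.isCovariantDerivativeOnUniv.leibniz hY' (hhd.comp (f x) hgd)
  simp only [pullbackAt]
  rw [mpullback_smul, this]
  have e1 : mpullback 𝓘(ℝ, E) 𝓘(ℝ, E) g Y (f x) = mfderiv 𝓘(ℝ, E) 𝓘(ℝ, E) f x (Y x) := by
    rw [mpullback_apply, hi.inverse_apply_eq, hx]
    have := DFunLike.congr_fun (mfderiv_comp_eq_id hf hg hgf) (Y x)
    exact this.symm
  have e2 : ∀ v, d% (h ∘ g) (f x) (mfderiv 𝓘(ℝ, E) 𝓘(ℝ, E) f x v) = d% h x v := by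
    intro v
    have h1 := mfderiv_comp x (hhd.comp (f x) hgd) (hf.mdifferentiableAt (by simp))
    have h2 : (h ∘ g) ∘ f =ᶠ[𝓝 x] h := by
      filter_upwards [hgf] with y hy using by simp [hy]
    rw [h2.mfderiv_eq] at h1
    exact (DFunLike.congr_fun h1 v).symm
  ext v
  simp [e1, e2, hx, hi'.inverse_apply_self]

end PullbackLaws

variable [FiniteDimensional ℝ E]

/-- The connection of an affine manifold: in an affine chart `φ` around a point it is the pullback
`φ⋆ ∇ᵉ` of the standard connection of `E`. -/
def affineConnection (M : Type*) [TopologicalSpace M] [ChartedSpace E M]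
    [HasGroupoid M (affineGroupoid E)] : Connection E M where
  toFun Y x := pullbackAt (chartAt E x) (chartAt E x).symm (euclideanConnection E) Y x
  isCovariantDerivativeOnUniv := by
    have := FiniteDimensional.complete ℝ E
    have hf (x : M) : ContMDiffAt 𝓘(ℝ, E) 𝓘(ℝ, E) ∞ (chartAt E x) x :=
      contMDiffAt_of_mem_maximalAtlas (IsManifold.chart_mem_maximalAtlas x)
        (mem_chart_source E x)
    have hg (x : M) : ContMDiffAt 𝓘(ℝ, E) 𝓘(ℝ, E) ∞ (chartAt E x).symm (chartAt E x x) :=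
      contMDiffAt_symm_of_mem_maximalAtlas (IsManifold.chart_mem_maximalAtlas x)
        (mem_chart_target E x)
    have hgf (x : M) := (chartAt E x).eventually_left_inverse (mem_chart_source E x)
    have hfg (x : M) := (chartAt E x).eventually_right_inverse (mem_chart_target E x)
    exact
      { add := fun {_ _ x} hY hZ _ =>
          pullbackAt_add _ (hf x) (hg x) (hgf x) (hfg x) hY hZ
        leibniz := fun {_ _ x} hY hh _ =>
          pullbackAt_leibniz _ (hf x) (hg x) (hgf x) (hfg x) hY hh }

/-- The pullback `π⋆ ∇` of a connection by a local diffeomorphism `π : N → M`. -/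
def pullbackConnection [IsManifold 𝓘(ℝ, E) ∞ M] [IsManifold 𝓘(ℝ, E) ∞ N] (π : N → M)
    (hπ : IsLocalDiffeomorph 𝓘(ℝ, E) 𝓘(ℝ, E) ∞ π) (D : Connection E M) : Connection E N where
  toFun Y x := pullbackAt π (hπ x).localInverse D Y x
  isCovariantDerivativeOnUniv := by
    have := FiniteDimensional.complete ℝ E
    exact
      { add := fun {_ _ x} hY hZ _ =>
          pullbackAt_add _ (hπ x).contMDiffAt (hπ x).localInverse_contMDiffAt
            (hπ x).localInverse_eventuallyEq_left (hπ x).localInverse_eventuallyEq_right hY hZ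
        leibniz := fun {_ _ x} hY hh _ =>
          pullbackAt_leibniz _ (hπ x).contMDiffAt (hπ x).localInverse_contMDiffAt
            (hπ x).localInverse_eventuallyEq_left (hπ x).localInverse_eventuallyEq_right hY hh }

end Connections

section ParallelTransport

variable {E : Type*} [NormedAddCommGroup E] [NormedSpace ℝ E]
  {N : Type*} [TopologicalSpace N] [ChartedSpace E N]

/-- `γ : [0,1] → N` is a `C¹` curve from `p` to `q` (values outside `[0,1]` are irrelevant). -/
structure IsCurve (E : Type*) [NormedAddCommGroup E] [NormedSpace ℝ E]
    {N : Type*} [TopologicalSpace N] [ChartedSpace E N] (γ : ℝ → N) (p q : N) : Prop where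
  contMDiffOn : ContMDiffOn 𝓘(ℝ, ℝ) 𝓘(ℝ, E) 1 γ (Icc 0 1)
  source : γ 0 = p
  target : γ 1 = q

/-- The velocity of a curve `[0,1] → N`. -/
def velocity (E : Type*) [NormedAddCommGroup E] [NormedSpace ℝ E]
    {N : Type*} [TopologicalSpace N] [ChartedSpace E N] (γ : ℝ → N) (t : ℝ) :
    TangentSpace 𝓘(ℝ, E) (γ t) :=
  mfderivWithin 𝓘(ℝ, ℝ) 𝓘(ℝ, E) γ (Icc 0 1) t (1 : ℝ)

variable [IsManifold 𝓘(ℝ, E) ∞ N]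

/-- The vector field `V` along `γ : [0,1] → N` has covariant derivative `w` at the time `t₀`.
If near `t₀` one has `V(t) = ∑ i, f i t • Y i (γ t)` with vector fields `Y i` that are smooth near
`γ t₀`, then the covariant derivative is
`∑ i, (f i)'(t₀) • Y i (γ t₀) + f i t₀ • (∇_{γ'(t₀)} (Y i))(γ t₀)`. -/
def HasCovariantDerivAlong (D : Connection E N) (γ : ℝ → N)
    (V : Π t : ℝ, TangentSpace 𝓘(ℝ, E) (γ t)) (t₀ : ℝ) (w : TangentSpace 𝓘(ℝ, E) (γ t₀)) : Prop :=
  ∃ (k : ℕ) (f : Fin k → ℝ → ℝ) (f' : Fin k → ℝ) (Y : Fin k → Π x : N, TangentSpace 𝓘(ℝ, E) x),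
    (∀ i, HasDerivWithinAt (f i) (f' i) (Icc 0 1) t₀) ∧
    (∀ i, CMDiffAt ∞ (T% (Y i)) (γ t₀)) ∧
    (∀ᶠ t in 𝓝[Icc 0 1] t₀, V t = ∑ i, f i t • Y i (γ t)) ∧
    w = ∑ i, (f' i • Y i (γ t₀) + f i t₀ • D (Y i) (γ t₀) (velocity E γ t₀))

/-- `V` is a parallel vector field along `γ : [0,1] → N`. -/
def IsParallelAlong (D : Connection E N) (γ : ℝ → N)
    (V : Π t : ℝ, TangentSpace 𝓘(ℝ, E) (γ t)) : Prop :=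
  ∀ t ∈ Icc (0 : ℝ) 1, HasCovariantDerivAlong D γ V t 0

/-- The tangent vector `ξ` at `γ 0` is carried to the tangent vector `η` at `γ 1` by a parallel
vector field along `γ`. -/
def IsTransportedAlong (D : Connection E N) (γ : ℝ → N) (ξ η : TangentBundle 𝓘(ℝ, E) N) : Prop :=
  ∃ V : Π t : ℝ, TangentSpace 𝓘(ℝ, E) (γ t), IsParallelAlong D γ V ∧
    (⟨γ 0, V 0⟩ : TangentBundle 𝓘(ℝ, E) N) = ξ ∧ (⟨γ 1, V 1⟩ : TangentBundle 𝓘(ℝ, E) N) = η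

/-- `P : T_p N → T_q N` is the parallel transport along every curve from `p` to `q`. -/
def IsParallelTransport (D : Connection E N) (p q : N)
    (P : TangentSpace 𝓘(ℝ, E) p →L[ℝ] TangentSpace 𝓘(ℝ, E) q) : Prop :=
  ∀ γ : ℝ → N, IsCurve E γ p q → ∀ (v : TangentSpace 𝓘(ℝ, E) p) (w : TangentSpace 𝓘(ℝ, E) q),
    IsTransportedAlong D γ ⟨p, v⟩ ⟨q, w⟩ ↔ w = P v

open Classical in
/-- The parallel transport `Π_p^q : T_p N → T_q N` of a connection whose parallel transport does not
depend on the curve (and `0` if there is no such operator). -/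
def parallelTransport (D : Connection E N) (p q : N) :
    TangentSpace 𝓘(ℝ, E) p →L[ℝ] TangentSpace 𝓘(ℝ, E) q :=
  if h : ∃ P, IsParallelTransport D p q P then h.choose else 0

/-- The integral `∫₀¹ Π_{γ(t)}^p (γ'(t)) dt` has the integrand `developingIntegrand D p γ`. -/
def developingIntegrand (D : Connection E N) (p : N) (γ : ℝ → N) (t : ℝ) : E :=
  parallelTransport D (γ t) p (velocity E γ t)

open Classical in
/-- The developing map `dev : N → T_p N`, `dev q = ∫₀¹ Π_{γ(t)}^p (γ'(t)) dt` for a chosen curve `γ`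
from `p` to `q`. (The integral is taken in `E`, the vector space underlying `T_p N`.) -/
def dev (D : Connection E N) (p q : N) : TangentSpace 𝓘(ℝ, E) p :=
  if h : ∃ γ : ℝ → N, IsCurve E γ p q then
    (∫ t in (0 : ℝ)..1, developingIntegrand D p h.choose t : E)
  else 0

end ParallelTransport

section Monodromy

/-- The group of deck transformations of `π : N → M`, under composition. -/
def deckGroup {N M : Type*} [TopologicalSpace N] (π : N → M) : Subgroup (N ≃ₜ N) where
  carrier := {φ | π ∘ φ = π}
  mul_mem' {φ ψ} hφ hψ := by
    change (π ∘ φ) ∘ ψ = π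
    rw [show π ∘ φ = π from hφ]
    exact hψ
  one_mem' := rfl
  inv_mem' {φ} hφ := by
    funext x
    have h := congrFun (show π ∘ φ = π from hφ) (φ.symm x)
    simpa using h.symm

variable {E : Type*} [NormedAddCommGroup E] [NormedSpace ℝ E]
  {N : Type*} [TopologicalSpace N] [ChartedSpace E N] [IsManifold 𝓘(ℝ, E) ∞ N]

/-- `A_φ = Π_{φ(p)}^p ∘ dφ_p`. -/
def linearPart (D : Connection E N) (p : N) (φ : N ≃ₜ N) :
    TangentSpace 𝓘(ℝ, E) p →L[ℝ] TangentSpace 𝓘(ℝ, E) p :=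
  (parallelTransport D (φ p) p) ∘L (mfderiv 𝓘(ℝ, E) 𝓘(ℝ, E) φ p)

/-- `b_φ = dev (φ(p))`. -/
def translationPart (D : Connection E N) (p : N) (φ : N ≃ₜ N) : TangentSpace 𝓘(ℝ, E) p :=
  dev D p (φ p)

/-- The affine transformation `m_φ (v) = A_φ v + b_φ` of `T_p N`. -/
def monodromyMap (D : Connection E N) (p : N) (φ : N ≃ₜ N) :
    TangentSpace 𝓘(ℝ, E) p →ᵃ[ℝ] TangentSpace 𝓘(ℝ, E) p :=
  (linearPart D p φ : TangentSpace 𝓘(ℝ, E) p →ₗ[ℝ] TangentSpace 𝓘(ℝ, E) p).toAffineMap +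
    AffineMap.const ℝ (TangentSpace 𝓘(ℝ, E) p) (translationPart D p φ)

end Monodromy

end AffineMonodromy

end

/-!
# The monodromy homomorphism of an affine manifold

Everything is reduced to one function. A *developing map* is a map `f : M' → E` which near every
point is `A ∘ c ∘ π` for an affine chart `c` of `M` and an affine automorphism `A` of `E`. The germs
of such maps form a bundle with discrete fibres, that is, a covering of `M`; as `M'` is simply
connected, `π` lifts to this covering, and a lift is a developing map (`exists_isDevelopingMap`).
Two affine automorphisms that agree on a nonempty open set are equal, so on the connected space `M'`
developing maps are unique up to an affine automorphism of `E` (`IsDevelopingMap.exists_eq_comp`).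

A developing map carries the pullback connection to the standard connection of `E`
(`IsDevelopingMap.isFlatAt`): this property survives each of the two pullbacks, along a chart and
along `π` (`IsFlatAt.comp`). Hence a vector field along a curve is parallel exactly when
its components `df (V t)` are constant, so parallel transport from `q` to `q'` is
`(df_{q'})⁻¹ ∘ df_q` along every curve (`isTransportedAlong_iff`), and by the fundamental theorem of
calculus `dev q = (df_p)⁻¹ (f q - f p)` (`dev_eq`). Curves between any two points exist by
connectedness (`exists_isCurve`).

If `φ` is a deck transformation then `f ∘ φ` is again a developing map, so `f ∘ φ = C ∘ f` with `C`
affine. Under `df_p` the linear part `A_φ` becomes the linear part of `C`, which is multiplicative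
in `φ`, and `dev ∘ φ = m_φ ∘ dev` is the equation `f ∘ φ = C ∘ f` rewritten
(`dev_apply_eq_monodromyMap`). Evaluating it at `ψ p` gives the rule for the translation parts.
-/

noncomputable section

namespace AffineMonodromy

open Filter

/-! ### Developing maps of an affine manifold -/

section DevelopingMap

variable {E : Type*} [NormedAddCommGroup E] [NormedSpace ℝ E]

theorem continuousAffineMap_eq_of_eventuallyEq {A B : E →ᴬ[ℝ] E} {z : E}
    (h : ∀ᶠ y in 𝓝 z, A y = B y) : A = B := by
  obtain ⟨u, hu, huo, hzu⟩ := eventually_nhds_iff.1 h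
  exact ContinuousAffineMap.toAffineMap_injective <|
    AffineMap.ext_on (huo.affineSpan_eq_top ⟨z, hzu⟩) hu

/-- An affine automorphism `A` is determined by the germ of `A ∘ h` where `h` is open. -/
theorem continuousAffineEquiv_eq_of_eventuallyEq {X : Type*} [TopologicalSpace X] {h : X → E}
    {x : X} (hh : 𝓝 (h x) ≤ map h (𝓝 x)) {A B : E ≃ᴬ[ℝ] E}
    (hAB : ∀ᶠ y in 𝓝 x, A (h y) = B (h y)) : A = B := by
  have h1 : ∀ᶠ z in 𝓝 (h x), A.toContinuousAffineMap z = B.toContinuousAffineMap z :=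
    hh (eventually_map.2 hAB)
  have h2 := continuousAffineMap_eq_of_eventuallyEq h1
  exact ContinuousAffineEquiv.ext fun y => DFunLike.congr_fun h2 y

variable {M : Type*} [TopologicalSpace M] [ChartedSpace E M]

theorem exists_affine_transition [HasGroupoid M (affineGroupoid E)]
    {e e' : OpenPartialHomeomorph M E} (he : e ∈ atlas E M) (he' : e' ∈ atlas E M) {x : M}
    (hx : x ∈ e.source) (hx' : x ∈ e'.source) :
    ∃ A : E ≃ᴬ[ℝ] E, ∀ᶠ y in 𝓝 x, e' y = A (e y) := by
  -- an affine expression of one coordinate change, valid near `x`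
  have key : ∀ e ∈ atlas E M, ∀ e' ∈ atlas E M, x ∈ e.source → x ∈ e'.source →
      ∃ A : E →ᴬ[ℝ] E, ∀ᶠ y in 𝓝 x, e' y = A (e y) := by
    intro e he e' he' hx hx'
    have h := (mem_groupoid_of_pregroupoid.1
      ((affineGroupoid E).compatible he he')).1 (e x) (by simp [hx, hx'])
    obtain ⟨u, hu, hxu, A, hA⟩ := h
    refine ⟨A, ?_⟩
    filter_upwards [e.open_source.mem_nhds hx, e'.open_source.mem_nhds hx',
      (e.continuousAt hx).preimage_mem_nhds (hu.mem_nhds hxu)] with y hy hy' hyu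
    have := @hA (e y) ⟨by simp [hy, hy'], hyu⟩
    simpa [hy] using this
  obtain ⟨A, hA⟩ := key e he e' he' hx hx'
  obtain ⟨B, hB⟩ := key e' he' e he hx' hx
  have hBA : B.comp A = ContinuousAffineMap.id ℝ E := by
    refine continuousAffineMap_eq_of_eventuallyEq (z := e x) ?_
    rw [← e.map_nhds_eq hx, eventually_map]
    filter_upwards [hA, hB] with y h1 h2
    simp [← h1, ← h2]
  have hAB : A.comp B = ContinuousAffineMap.id ℝ E := by
    refine continuousAffineMap_eq_of_eventuallyEq (z := e' x) ?_
    rw [← e'.map_nhds_eq hx', eventually_map]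
    filter_upwards [hA, hB] with y h1 h2
    simp [← h1, ← h2]
  have hl : ∀ z, B (A z) = z := fun z => DFunLike.congr_fun hBA z
  have hr : ∀ z, A (B z) = z := fun z => DFunLike.congr_fun hAB z
  let eqv : E ≃ᵃ[ℝ] E :=
    { toFun := A, invFun := B, left_inv := hl, right_inv := hr
      linear := LinearEquiv.ofBijective (A : E →ᵃ[ℝ] E).linear
        ((A : E →ᵃ[ℝ] E).linear_bijective_iff.2
          (Function.bijective_iff_has_inverse.2 ⟨B, hl, hr⟩))
      map_vadd' := fun p v => (A : E →ᵃ[ℝ] E).map_vadd p v }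
  exact ⟨{ eqv with
    continuous_toFun := A.continuous, continuous_invFun := B.continuous }, hA⟩

open Classical in
/-- The affine map `A` with `e' = A ∘ e` near `x`, for charts `e`, `e'` around `x`
(and the identity if there is no such map). -/
def affineTransition (e e' : atlas E M) (x : M) : E ≃ᴬ[ℝ] E :=
  if h : ∃ A : E ≃ᴬ[ℝ] E, ∀ᶠ y in 𝓝 x, e'.1 y = A (e.1 y) then h.choose else .refl ℝ E

theorem affineTransition_spec [HasGroupoid M (affineGroupoid E)] {e e' : atlas E M} {x : M}
    (hx : x ∈ e.1.source) (hx' : x ∈ e'.1.source) :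
    ∀ᶠ y in 𝓝 x, e'.1 y = affineTransition e e' x (e.1 y) := by
  have h := exists_affine_transition e.2 e'.2 hx hx'
  rw [affineTransition, dif_pos h]
  exact h.choose_spec

theorem affineTransition_eq {e e' : atlas E M} {x : M} (hx : x ∈ e.1.source) {A : E ≃ᴬ[ℝ] E}
    (hA : ∀ᶠ y in 𝓝 x, e'.1 y = A (e.1 y)) : affineTransition e e' x = A := by
  have h : ∃ A : E ≃ᴬ[ℝ] E, ∀ᶠ y in 𝓝 x, e'.1 y = A (e.1 y) := ⟨A, hA⟩
  rw [affineTransition, dif_pos h]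
  refine continuousAffineEquiv_eq_of_eventuallyEq (e.1.map_nhds_eq hx).ge ?_
  filter_upwards [hA, h.choose_spec] with y h1 h2
  rw [← h1, ← h2]

/-- The fibre of the bundle of germs of affine charts: the affine automorphisms of `E`, with the
discrete topology. -/
def AffineGerm (E : Type*) [NormedAddCommGroup E] [NormedSpace ℝ E] : Type _ := E ≃ᴬ[ℝ] E

instance : TopologicalSpace (AffineGerm E) := ⊥

instance : DiscreteTopology (AffineGerm E) := ⟨rfl⟩

variable (E M) in
/-- The bundle of germs of affine charts of `M`. The element `A` of the fibre over `x` stands, in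
the trivialization given by the chart `e`, for the germ of `A ∘ e` at `x`. -/
def affineGermBundle [HasGroupoid M (affineGroupoid E)] :
    FiberBundleCore (atlas E M) M (AffineGerm E) where
  baseSet e := e.1.source
  isOpen_baseSet e := e.1.open_source
  indexAt x := achart E x
  mem_baseSet_at x := mem_chart_source E x
  coordChange e e' x A := (affineTransition e' e x).trans A
  coordChange_self e x hx A := by
    rw [affineTransition_eq (A := .refl ℝ E) hx (Eventually.of_forall fun _ => rfl)]
    exact ContinuousAffineEquiv.refl_trans _
  continuousOn_coordChange e e' := by
    rintro ⟨x, A⟩ ⟨⟨hx, hx'⟩, -⟩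
    -- the transition is locally constant in `x`, and `A` is isolated in the fibre
    have h1 : ∀ᶠ y in 𝓝 x, affineTransition e' e y = affineTransition e' e x := by
      filter_upwards [eventually_eventually_nhds.2 (affineTransition_spec hx' hx),
        e'.1.open_source.mem_nhds hx'] with y hy hy' using affineTransition_eq hy' hy
    have h2 : ∀ᶠ q : M × AffineGerm E in 𝓝 (x, A), q.2 = A :=
      continuous_snd.continuousAt.preimage_mem_nhds
        ((isOpen_discrete {A}).mem_nhds (mem_singleton A))
    let B : AffineGerm E := (affineTransition e' e x).trans A
    refine ((continuousAt_const (y := B)).congr ?_).continuousWithinAt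
    filter_upwards [h2, continuous_fst.continuousAt.eventually h1] with q hq2 hq1
    rw [hq1, hq2]
  coordChange_comp e e' e'' x hx A := by
    obtain ⟨⟨hx, hx'⟩, hx''⟩ := hx
    have h : affineTransition e'' e x =
        (affineTransition e'' e' x).trans (affineTransition e' e x) := by
      refine affineTransition_eq hx'' ?_
      filter_upwards [affineTransition_spec hx'' hx', affineTransition_spec hx' hx] with y h1 h2
      rw [ContinuousAffineEquiv.trans_apply, ← h1, ← h2]
    rw [h]
    exact (ContinuousAffineEquiv.trans_assoc _ _ _).symm

variable {N : Type*}

/-- `f : N → E` is a developing map over `π : N → M`: near every point it is `A ∘ φ ∘ π` for an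
affine chart `φ` of `M` and an affine automorphism `A` of `E`. -/
def IsDevelopingMap [TopologicalSpace N] (π : N → M) (f : N → E) : Prop :=
  ∀ y, ∃ A : E ≃ᴬ[ℝ] E, ∀ᶠ z in 𝓝 y, f z = A (chartAt E (π y) (π z))

/-- Over a simply connected space the bundle of germs of affine charts has a section, because it is
a covering; a section of germs is a developing map. -/
theorem exists_isDevelopingMap [HasGroupoid M (affineGroupoid E)] [TopologicalSpace N]
    [SimplyConnectedSpace N] [LocallyPathConnectedSpace N] {π : N → M} (hπ : Continuous π) :
    ∃ f : N → E, IsDevelopingMap π f := by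
  let Z := affineGermBundle E M
  have hcov : IsCoveringMap (Bundle.TotalSpace.proj : Z.TotalSpace → M) := FiberBundle.isCoveringMap
  obtain ⟨y₀⟩ : Nonempty N := inferInstance
  let s₀ : Z.TotalSpace := ⟨π y₀, (ContinuousAffineEquiv.refl ℝ E : E ≃ᴬ[ℝ] E)⟩
  obtain ⟨s, ⟨-, hs⟩, -⟩ :=
    hcov.existsUnique_continuousMap_lifts (⟨π, hπ⟩ : C(N, M)) y₀ s₀ rfl
  have hs' : ∀ y, (s y).proj = π y := fun y => congrFun hs y
  let val (w : Z.TotalSpace) : E :=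
    let A : E ≃ᴬ[ℝ] E := w.2
    A (chartAt E w.1 w.1)
  refine ⟨fun y => val (s y), fun y => ?_⟩
  let i : atlas E M := achart E (π y)
  let B : N → AffineGerm E := fun z => (Z.localTriv i (s z)).2
  have hB : ContinuousAt B y := by
    refine continuous_snd.continuousAt.comp (ContinuousAt.comp ?_ s.continuous.continuousAt)
    refine (Z.localTriv i).toOpenPartialHomeomorph.continuousAt ?_
    change (s y).proj ∈ (chartAt E (π y)).source
    rw [hs']
    exact mem_chart_source E _
  have hB' : ∀ᶠ z in 𝓝 y, B z = B y :=
    hB.preimage_mem_nhds ((isOpen_discrete {B y}).mem_nhds rfl)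
  refine ⟨B y, ?_⟩
  filter_upwards [hB', hπ.continuousAt.preimage_mem_nhds (chart_source_mem_nhds E (π y))]
    with z hz hz'
  rw [← hz, ← hs' z]
  have hz'' : (s z).proj ∈ i.1.source := by rw [hs']; exact hz'
  have h := (affineTransition_spec (e := i) (e' := achart E (s z).proj) hz''
    (mem_chart_source E _)).self_of_nhds
  let A : E ≃ᴬ[ℝ] E := (s z).2
  exact congrArg A h

theorem IsDevelopingMap.map_nhds_eq [TopologicalSpace N] {π : N → M} {f : N → E}
    (hf : IsDevelopingMap π f) (hπ : IsLocalHomeomorph π) (y : N) : map f (𝓝 y) = 𝓝 (f y) := by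
  obtain ⟨A, hA⟩ := hf y
  have h1 : map (fun z => A (chartAt E (π y) (π z))) (𝓝 y) = 𝓝 (A (chartAt E (π y) (π y))) := by
    change map (A ∘ chartAt E (π y) ∘ π) (𝓝 y) = _
    rw [← map_map, ← map_map, hπ.map_nhds_eq, (chartAt E (π y)).map_nhds_eq
      (mem_chart_source E _)]
    exact A.toHomeomorph.map_nhds_eq _
  rw [map_congr hA, h1, hA.self_of_nhds]

/-- Developing maps over a connected space are unique up to an affine automorphism of `E`. -/
theorem IsDevelopingMap.exists_eq_comp [TopologicalSpace N] [ConnectedSpace N] {π : N → M}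
    {f g : N → E} (hf : IsDevelopingMap π f) (hg : IsDevelopingMap π g)
    (hπ : IsLocalHomeomorph π) : ∃ C : E ≃ᴬ[ℝ] E, ∀ y, g y = C (f y) := by
  have hloc : ∀ y, ∃ C : E ≃ᴬ[ℝ] E, ∀ᶠ z in 𝓝 y, g z = C (f z) := by
    intro y
    obtain ⟨A, hA⟩ := hf y
    obtain ⟨B, hB⟩ := hg y
    refine ⟨A.symm.trans B, ?_⟩
    filter_upwards [hA, hB] with z h1 h2
    simp [h1, h2]
  obtain ⟨y₀⟩ : Nonempty N := inferInstance
  obtain ⟨C, hC⟩ := hloc y₀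
  refine ⟨C, fun y => ?_⟩
  have hclopen : IsClopen {y | ∀ᶠ z in 𝓝 y, g z = C (f z)} := by
    refine ⟨isClosed_iff_frequently.2 fun y hy => ?_,
      isOpen_iff_mem_nhds.2 fun y hy => eventually_eventually_nhds.2 hy⟩
    obtain ⟨C', hC'⟩ := hloc y
    obtain ⟨z, hz, hz'⟩ := (hy.and_eventually (eventually_eventually_nhds.2 hC')).exists
    have : C' = C := by
      refine continuousAffineEquiv_eq_of_eventuallyEq (hf.map_nhds_eq hπ z).ge ?_
      filter_upwards [hz, hz'] with w h1 h2
      rw [← h1, ← h2]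
    exact this ▸ hC'
  have := hclopen.eq_univ ⟨y₀, hC⟩
  exact (this.ge (mem_univ y) : ∀ᶠ z in 𝓝 y, g z = C (f z)).self_of_nhds

end DevelopingMap

/-! ### Flat coordinates of a connection -/

section FlatCoordinates

variable {E : Type*} [NormedAddCommGroup E] [NormedSpace ℝ E]
  {N M : Type*} [TopologicalSpace N] [ChartedSpace E N] [TopologicalSpace M] [ChartedSpace E M]

/-- `h : N → E` is smooth at `x` with invertible differential there, and carries the connection `D`
to the standard connection of `E` at the point `x`: for vector fields `Y`, the derivative of the
`E`-valued function `y ↦ dh_y (Y y)` in the direction `v` is `dh_x ((∇_v Y)(x))`. -/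
structure IsFlatAt [IsManifold 𝓘(ℝ, E) 1 N] (D : Connection E N) (h : N → E) (x : N) : Prop where
  contMDiffAt : ContMDiffAt 𝓘(ℝ, E) 𝓘(ℝ, E) ∞ h x
  isInvertible : (mfderiv 𝓘(ℝ, E) 𝓘(ℝ, E) h x).IsInvertible
  mfderiv_apply : ∀ Y : Π x : N, TangentSpace 𝓘(ℝ, E) x, MDiffAt (T% Y) x →
    ∀ v : TangentSpace 𝓘(ℝ, E) x, mfderiv 𝓘(ℝ, E) 𝓘(ℝ, E) h x (D Y x v) =
      mfderiv 𝓘(ℝ, E) 𝓘(ℝ, E) (fun y => (mfderiv 𝓘(ℝ, E) 𝓘(ℝ, E) h y (Y y) : E)) x v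

theorem IsFlatAt.congr [IsManifold 𝓘(ℝ, E) 1 N] {D : Connection E N} {h h' : N → E} {x : N}
    (H : IsFlatAt D h x) (hh : h' =ᶠ[𝓝 x] h) : IsFlatAt D h' x where
  contMDiffAt := H.contMDiffAt.congr_of_eventuallyEq hh
  isInvertible := by rw [hh.mfderiv_eq]; exact H.isInvertible
  mfderiv_apply Y hY v := by
    have h1 : (fun y => (mfderiv 𝓘(ℝ, E) 𝓘(ℝ, E) h' y (Y y) : E)) =ᶠ[𝓝 x]
        fun y => (mfderiv 𝓘(ℝ, E) 𝓘(ℝ, E) h y (Y y) : E) := by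
      filter_upwards [hh.eventuallyEq_nhds] with y hy
      rw [hy.mfderiv_eq]
      rfl
    rw [hh.mfderiv_eq, h1.mfderiv_eq]
    exact H.mfderiv_apply Y hY v

theorem hasMFDerivAt_continuousAffineEquiv (A : E ≃ᴬ[ℝ] E) (x : E) :
    HasMFDerivAt 𝓘(ℝ, E) 𝓘(ℝ, E) A x A.toContinuousAffineMap.contLinear :=
  A.toContinuousAffineMap.hasFDerivAt.hasMFDerivAt

theorem isInvertible_contLinear (A : E ≃ᴬ[ℝ] E) :
    (A.toContinuousAffineMap.contLinear).IsInvertible := by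
  have key : ∀ B : E ≃ᴬ[ℝ] E, B.symm.toContinuousAffineMap.contLinear ∘L
      B.toContinuousAffineMap.contLinear = .id ℝ E := by
    intro B
    have h := (B.symm.toContinuousAffineMap.hasFDerivAt (x := B 0)).comp 0
      B.toContinuousAffineMap.hasFDerivAt
    have h2 : B.symm.toContinuousAffineMap ∘ B = id := funext fun y => B.symm_apply_apply y
    exact (h2 ▸ h).unique (hasFDerivAt_id 0)
  exact .of_inverse (key A.symm) (key A)

/-- Affine automorphisms of `E` preserve the standard connection. -/
theorem isFlatAt_euclideanConnection (A : E ≃ᴬ[ℝ] E) (x : E) :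
    IsFlatAt (euclideanConnection E) A x where
  contMDiffAt := A.toContinuousAffineMap.contDiff.contDiffAt.contMDiffAt
  isInvertible := by
    rw [(hasMFDerivAt_continuousAffineEquiv A x).mfderiv]
    exact isInvertible_contLinear A
  mfderiv_apply Y hY v := by
    have h1 : (fun y : E => (mfderiv 𝓘(ℝ, E) 𝓘(ℝ, E) A y (Y y) : E)) =
        A.toContinuousAffineMap.contLinear ∘ (Y : E → E) := by
      funext y
      rw [(hasMFDerivAt_continuousAffineEquiv A y).mfderiv]
      rfl
    have h2 := (A.toContinuousAffineMap.contLinear.hasFDerivAt (x := Y x)).comp x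
      (differentiableAt_of_vectorField hY).hasFDerivAt
    rw [(hasMFDerivAt_continuousAffineEquiv A x).mfderiv, h1]
    exact (DFunLike.congr_fun h2.hasMFDerivAt.mfderiv v).symm

/-- The `E`-valued function `y ↦ dh_y (Y y)` expressing a differentiable vector field `Y` in smooth
coordinates `h` is differentiable. -/
theorem mdifferentiableAt_mfderiv_apply [IsManifold 𝓘(ℝ, E) ∞ N] {h : N → E} {x : N}
    (hh : ContMDiffAt 𝓘(ℝ, E) 𝓘(ℝ, E) ∞ h x) {Y : Π x : N, TangentSpace 𝓘(ℝ, E) x}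
    (hY : MDiffAt (T% Y) x) :
    MDifferentiableAt 𝓘(ℝ, E) 𝓘(ℝ, E)
      (fun y => (mfderiv 𝓘(ℝ, E) 𝓘(ℝ, E) h y (Y y) : E)) x := by
  obtain ⟨u, hu, hhu⟩ := (contMDiffAt_iff_contMDiffOn_nhds (n := 2) (by simp)).1
    (hh.of_le ENat.LEInfty.out)
  obtain ⟨w, hwu, hwo, hxw⟩ := mem_nhds_iff.1 hu
  have h1 := (hhu.mono hwu).contMDiffOn_tangentMapWithin (m := 1) le_rfl hwo.uniqueMDiffOn
  have h2 : ContMDiffAt 𝓘(ℝ, E).tangent 𝓘(ℝ, E).tangent 1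
      (tangentMapWithin 𝓘(ℝ, E) 𝓘(ℝ, E) h w) (⟨x, Y x⟩ : TangentBundle 𝓘(ℝ, E) N) :=
    h1.contMDiffAt ((hwo.preimage (FiberBundle.continuous_proj E _)).mem_nhds hxw)
  have h3 := (h2.mdifferentiableAt one_ne_zero).comp x hY
  have h4 := ((contMDiff_snd_tangentBundle_modelSpace (n := 1) E
    𝓘(ℝ, E)).contMDiffAt.mdifferentiableAt one_ne_zero).comp x h3
  refine h4.congr_of_eventuallyEq ?_
  filter_upwards [hwo.mem_nhds hxw] with y hy
  have h5 : mfderivWithin 𝓘(ℝ, E) 𝓘(ℝ, E) h w y = mfderiv 𝓘(ℝ, E) 𝓘(ℝ, E) h y :=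
    mfderivWithin_of_isOpen hwo hy
  exact (DFunLike.congr_fun h5 (Y y)).symm

/-- Flat coordinates of `D` at `f x` pull back, along a local diffeomorphism `f`, to flat
coordinates of the pullback of `D` at `x`. -/
theorem IsFlatAt.comp [IsManifold 𝓘(ℝ, E) ∞ M] [IsManifold 𝓘(ℝ, E) ∞ N] [CompleteSpace E]
    {D : Connection E M} {D' : Connection E N} {f : N → M} {g : M → N} {h : M → E} {x : N}
    (H : IsFlatAt D h (f x)) (hD : ∀ Y, D' Y x = pullbackAt f g D Y x)
    (hf : ∀ᶠ y in 𝓝 x, ContMDiffAt 𝓘(ℝ, E) 𝓘(ℝ, E) ∞ f y)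
    (hg : ∀ᶠ y in 𝓝 (f x), ContMDiffAt 𝓘(ℝ, E) 𝓘(ℝ, E) ∞ g y)
    (hgf : ∀ᶠ y in 𝓝 x, g (f y) = y) (hfg : ∀ᶠ y in 𝓝 (f x), f (g y) = y) :
    IsFlatAt D' (h ∘ f) x := by
  have hfx := hf.self_of_nhds
  have hgx := hg.self_of_nhds
  have hx : g (f x) = x := hgf.self_of_nhds
  obtain ⟨hi', hi⟩ := isInvertible_mfderiv hfx hgx hgf hfg
  have hcomp := mfderiv_comp x (H.contMDiffAt.mdifferentiableAt (by simp))
    (hfx.mdifferentiableAt (by simp))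
  refine ⟨H.contMDiffAt.comp x hfx, by rw [hcomp]; exact H.isInvertible.comp hi', ?_⟩
  intro Y hY v
  have hY' := MDifferentiableAt.mpullback_vectorField (x₀ := f x) (f := g) (V := Y) (n := 2)
    (by rw [hx]; exact hY) (hgx.of_le ENat.LEInfty.out) hi le_rfl
  have e1 : mfderiv 𝓘(ℝ, E) 𝓘(ℝ, E) (h ∘ f) x (D' Y x v) =
      mfderiv 𝓘(ℝ, E) 𝓘(ℝ, E) h (f x) (D (mpullback 𝓘(ℝ, E) 𝓘(ℝ, E) g Y) (f x)
        (mfderiv 𝓘(ℝ, E) 𝓘(ℝ, E) f x v)) := by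
    rw [hcomp, hD]
    simp only [pullbackAt, ContinuousLinearMap.comp_apply]
    rw [hi'.self_apply_inverse]
  have e2 : (fun y => (mfderiv 𝓘(ℝ, E) 𝓘(ℝ, E) h y
        (mpullback 𝓘(ℝ, E) 𝓘(ℝ, E) g Y y) : E)) ∘ f =ᶠ[𝓝 x]
      fun y => (mfderiv 𝓘(ℝ, E) 𝓘(ℝ, E) (h ∘ f) y (Y y) : E) := by
    have hh : ∀ᶠ y in 𝓝 (f x), ContMDiffAt 𝓘(ℝ, E) 𝓘(ℝ, E) 1 h y :=
      (contMDiffAt_iff_contMDiffAt_nhds (by simp)).1 (H.contMDiffAt.of_le ENat.LEInfty.out)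
    have hc := hfx.continuousAt
    filter_upwards [hf, hc.eventually hg, eventually_eventually_nhds.2 hgf,
      hc.eventually (eventually_eventually_nhds.2 hfg), hc.eventually hh]
      with y hfy hgy hgfy hfgy hhy
    have hy : g (f y) = y := hgfy.self_of_nhds
    have hiy := (isInvertible_mfderiv hfy hgy hgfy hfgy).2
    have e3 : mpullback 𝓘(ℝ, E) 𝓘(ℝ, E) g Y (f y) = mfderiv 𝓘(ℝ, E) 𝓘(ℝ, E) f y (Y y) := by
      rw [mpullback_apply, hiy.inverse_apply_eq, hy]
      exact (DFunLike.congr_fun (mfderiv_comp_eq_id hfy hgy hgfy) (Y y)).symm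
    rw [mfderiv_comp y (hhy.mdifferentiableAt one_ne_zero) (hfy.mdifferentiableAt (by simp))]
    exact congrArg (mfderiv 𝓘(ℝ, E) 𝓘(ℝ, E) h (f y)) e3
  rw [e1, H.mfderiv_apply _ hY', ← e2.mfderiv_eq, mfderiv_comp x
    (mdifferentiableAt_mfderiv_apply H.contMDiffAt hY') (hfx.mdifferentiableAt (by simp))]
  rfl

variable [FiniteDimensional ℝ E] [HasGroupoid M (affineGroupoid E)]

theorem isFlatAt_affineConnection (A : E ≃ᴬ[ℝ] E) (x : M) :
    IsFlatAt (affineConnection M) (A ∘ chartAt E x) x := by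
  have := FiniteDimensional.complete ℝ E
  have hx := mem_chart_source E x
  refine (isFlatAt_euclideanConnection A (chartAt E x x)).comp (g := (chartAt E x).symm)
    (fun Y => rfl) ?_ ?_ ((chartAt E x).eventually_left_inverse hx)
    ((chartAt E x).eventually_right_inverse (mem_chart_target E x))
  · filter_upwards [(chartAt E x).open_source.mem_nhds hx] with y hy using
      contMDiffAt_of_mem_maximalAtlas (IsManifold.chart_mem_maximalAtlas x) hy
  · filter_upwards [(chartAt E x).open_target.mem_nhds (mem_chart_target E x)] with y hy using
      contMDiffAt_symm_of_mem_maximalAtlas (IsManifold.chart_mem_maximalAtlas x) hy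

/-- A developing map is a system of flat coordinates for the pullback of the connection of an
affine manifold. -/
theorem IsDevelopingMap.isFlatAt [IsManifold 𝓘(ℝ, E) ∞ N] {π : N → M} {f : N → E}
    (hf : IsDevelopingMap π f) (hπ : IsLocalDiffeomorph 𝓘(ℝ, E) 𝓘(ℝ, E) ∞ π) (y : N) :
    IsFlatAt (pullbackConnection π hπ (affineConnection M)) f y := by
  have := FiniteDimensional.complete ℝ E
  obtain ⟨A, hA⟩ := hf y
  refine IsFlatAt.congr ?_ hA
  refine (isFlatAt_affineConnection A (π y)).comp (g := (hπ y).localInverse) (fun Y => rfl)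
    (Eventually.of_forall fun z => (hπ z).contMDiffAt) ?_
    (hπ y).localInverse_eventuallyEq_left (hπ y).localInverse_eventuallyEq_right
  filter_upwards [(hπ y).localInverse_open_source.mem_nhds (hπ y).localInverse_mem_source] with z hz
  exact (hπ y).localInverse_contMDiffOn.contMDiffAt
    ((hπ y).localInverse_open_source.mem_nhds hz)

end FlatCoordinates

/-! ### Parallel transport and integration in flat coordinates -/

section FlatTransport

variable {E : Type*} [NormedAddCommGroup E] [NormedSpace ℝ E]
  {N : Type*} [TopologicalSpace N] [ChartedSpace E N]

/-- The differential `df_x : T_x N → E` of a function `f : N → E`. -/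
def differential (f : N → E) (x : N) : TangentSpace 𝓘(ℝ, E) x →L[ℝ] E :=
  mfderiv 𝓘(ℝ, E) 𝓘(ℝ, E) f x

theorem IsCurve.mdifferentiableWithinAt {γ : ℝ → N} {p q : N} (hγ : IsCurve E γ p q) {t : ℝ}
    (ht : t ∈ Icc (0 : ℝ) 1) : MDifferentiableWithinAt 𝓘(ℝ, ℝ) 𝓘(ℝ, E) γ (Icc 0 1) t :=
  (hγ.contMDiffOn t ht).mdifferentiableWithinAt one_ne_zero

theorem hasDerivWithinAt_comp_curve {γ : ℝ → N} {t : ℝ}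
    (hγ : MDifferentiableWithinAt 𝓘(ℝ, ℝ) 𝓘(ℝ, E) γ (Icc 0 1) t) {g : N → E}
    (hg : MDifferentiableAt 𝓘(ℝ, E) 𝓘(ℝ, E) g (γ t)) :
    HasDerivWithinAt (g ∘ γ) (differential g (γ t) (velocity E γ t)) (Icc 0 1) t := by
  have h := hg.hasMFDerivAt.comp_hasMFDerivWithinAt t hγ.hasMFDerivWithinAt
  have h' : HasFDerivWithinAt (g ∘ γ) ((differential g (γ t) : E →L[ℝ] E) ∘L
      (mfderivWithin 𝓘(ℝ, ℝ) 𝓘(ℝ, E) γ (Icc 0 1) t : ℝ →L[ℝ] E)) (Icc 0 1) t :=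
    hasMFDerivWithinAt_iff_hasFDerivWithinAt.1 h
  exact h'.hasDerivWithinAt

variable [IsManifold 𝓘(ℝ, E) ∞ N] {D : Connection E N} {f : N → E}

theorem IsFlatAt.differential_isInvertible {x : N} (H : IsFlatAt D f x) :
    (differential f x).IsInvertible := H.isInvertible

/-- A vector field along a curve is differentiated covariantly by differentiating its components
in flat coordinates. -/
theorem HasCovariantDerivAlong.hasDerivWithinAt {γ : ℝ → N} {t : ℝ} (H : IsFlatAt D f (γ t))
    (hγ : MDifferentiableWithinAt 𝓘(ℝ, ℝ) 𝓘(ℝ, E) γ (Icc 0 1) t) (ht : t ∈ Icc (0 : ℝ) 1)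
    {V : Π t : ℝ, TangentSpace 𝓘(ℝ, E) (γ t)} {w : TangentSpace 𝓘(ℝ, E) (γ t)}
    (hV : HasCovariantDerivAlong D γ V t w) :
    HasDerivWithinAt (fun s => differential f (γ s) (V s)) (differential f (γ t) w)
      (Icc 0 1) t := by
  obtain ⟨k, a, a', Y, ha, hY, hVa, rfl⟩ := hV
  have hYd : ∀ i, HasDerivWithinAt (fun s => differential f (γ s) (Y i (γ s)))
      (differential f (γ t) (D (Y i) (γ t) (velocity E γ t))) (Icc 0 1) t := by
    intro i
    have hYi := (hY i).mdifferentiableAt (by simp)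
    have h := hasDerivWithinAt_comp_curve hγ (mdifferentiableAt_mfderiv_apply H.contMDiffAt hYi)
    have e : differential f (γ t) (D (Y i) (γ t) (velocity E γ t)) =
        differential (fun y => differential f y (Y i y)) (γ t) (velocity E γ t) :=
      H.mfderiv_apply (Y i) hYi _
    rw [e]
    exact h
  have hsum : HasDerivWithinAt (fun s => ∑ i, a i s • differential f (γ s) (Y i (γ s)))
      (∑ i, (a i t • differential f (γ t) (D (Y i) (γ t) (velocity E γ t)) +
        a' i • differential f (γ t) (Y i (γ t)))) (Icc 0 1) t :=
    HasDerivWithinAt.fun_sum fun i _ => (ha i).smul (hYd i)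
  have heq : (fun s => differential f (γ s) (V s)) =ᶠ[𝓝[Icc 0 1] t]
      fun s => ∑ i, a i s • differential f (γ s) (Y i (γ s)) := by
    filter_upwards [hVa] with s hs
    rw [hs, map_sum]
    simp only [map_smul]
  convert hsum.congr_of_eventuallyEq heq (heq.self_of_nhdsWithin ht) using 1
  rw [map_sum]
  refine Finset.sum_congr rfl fun i _ => ?_
  rw [map_add, map_smul, map_smul, add_comm]

/-- The vector field with constant components in flat coordinates is parallel. -/
theorem isParallelAlong_inverse_differential [CompleteSpace E] (H : ∀ x, IsFlatAt D f x)
    (γ : ℝ → N) (c : E) :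
    IsParallelAlong D γ (fun t => (differential f (γ t)).inverse c) := by
  intro t _
  let Y : Π x : N, TangentSpace 𝓘(ℝ, E) x := fun x => (differential f x).inverse c
  have hY : CMDiffAt ∞ (T% Y) (γ t) := by
    have hc : ContMDiffAt 𝓘(ℝ, E) 𝓘(ℝ, E).tangent ∞
        (fun x : E => (⟨x, c⟩ : TangentBundle 𝓘(ℝ, E) E)) (f (γ t)) :=
      (contMDiffAt_vectorSpace_iff_contDiffAt (V := fun _ => c)).2 contDiffAt_const
    exact hc.mpullback_vectorField_preimage (H (γ t)).contMDiffAt (H (γ t)).isInvertible le_rfl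
  have hDY : D Y (γ t) (velocity E γ t) = 0 := by
    have h := (H (γ t)).mfderiv_apply Y (hY.mdifferentiableAt (by simp)) (velocity E γ t)
    have hconst : (fun y => (mfderiv 𝓘(ℝ, E) 𝓘(ℝ, E) f y (Y y) : E)) = fun _ => c :=
      funext fun y => (H y).differential_isInvertible.self_apply_inverse c
    rw [hconst, mfderiv_const] at h
    exact (H (γ t)).isInvertible.injective (h.trans (map_zero _).symm)
  -- the field along `γ` is the restriction of the single vector field `Y`, with coefficient `1`
  refine ⟨1, fun _ _ => 1, fun _ => 0, fun _ => Y, fun _ => hasDerivWithinAt_const _ _ _,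
    fun _ => hY, Eventually.of_forall fun s => ?_, ?_⟩
  · simp [Y]
  · simp [hDY]

theorem isTransportedAlong_iff [CompleteSpace E] (H : ∀ x, IsFlatAt D f x) {γ : ℝ → N} {p q : N}
    (hγ : IsCurve E γ p q) (v : TangentSpace 𝓘(ℝ, E) p) (w : TangentSpace 𝓘(ℝ, E) q) :
    IsTransportedAlong D γ ⟨p, v⟩ ⟨q, w⟩ ↔ differential f p v = differential f q w := by
  have hdiff := fun t => hγ.mdifferentiableWithinAt (t := t)
  obtain ⟨-, rfl, rfl⟩ := hγ
  constructor
  · rintro ⟨V, hV, h0, h1⟩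
    obtain rfl : V 0 = v := by simpa using h0
    obtain rfl : V 1 = w := by simpa using h1
    have hd : ∀ t ∈ Icc (0 : ℝ) 1,
        HasDerivWithinAt (fun s => differential f (γ s) (V s)) 0 (Icc 0 1) t := by
      intro t ht
      simpa using (hV t ht).hasDerivWithinAt (H _) (hdiff t ht) ht
    have := (convex_Icc (0 : ℝ) 1).norm_image_sub_le_of_norm_hasDerivWithin_le (C := 0) hd
      (by simp) (left_mem_Icc.2 zero_le_one) (right_mem_Icc.2 zero_le_one)
    exact (sub_eq_zero.1 (norm_le_zero_iff.1 (by simpa using this))).symm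
  · intro h
    refine ⟨_, isParallelAlong_inverse_differential H γ (differential f (γ 0) v), ?_, ?_⟩
    · rw [(H _).differential_isInvertible.inverse_apply_self]
    · rw [h, (H _).differential_isInvertible.inverse_apply_self]

theorem isParallelTransport_of_isFlatAt [CompleteSpace E] (H : ∀ x, IsFlatAt D f x) (p q : N) :
    IsParallelTransport D p q ((differential f q).inverse ∘L differential f p) := by
  intro γ hγ v w
  rw [isTransportedAlong_iff H hγ, ContinuousLinearMap.comp_apply, eq_comm (a := w),
    (H q).differential_isInvertible.inverse_apply_eq]

theorem isParallelTransport_parallelTransport [CompleteSpace E] (H : ∀ x, IsFlatAt D f x)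
    (p q : N) : IsParallelTransport D p q (parallelTransport D p q) := by
  have h : ∃ P, IsParallelTransport D p q P := ⟨_, isParallelTransport_of_isFlatAt H p q⟩
  rw [parallelTransport, dif_pos h]
  exact h.choose_spec

/-- A curve from `p` to `q` is needed for uniqueness: if there were none, every operator would be
a parallel transport from `p` to `q`. -/
theorem parallelTransport_eq [CompleteSpace E] (H : ∀ x, IsFlatAt D f x) {p q : N}
    (hc : ∃ γ : ℝ → N, IsCurve E γ p q) :
    parallelTransport D p q = (differential f q).inverse ∘L differential f p := by
  obtain ⟨γ, hγ⟩ := hc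
  ext v
  exact (isParallelTransport_of_isFlatAt H p q γ hγ v _).1
    ((isParallelTransport_parallelTransport H p q γ hγ v _).2 rfl)

/-- The integrand of the developing map is the derivative of the curve in flat coordinates. -/
theorem developingIntegrand_eq [CompleteSpace E] (H : ∀ x, IsFlatAt D f x) {γ : ℝ → N} {p q : N}
    (hc : ∀ x : N, ∃ γ : ℝ → N, IsCurve E γ x p) (hγ : IsCurve E γ p q) {t : ℝ}
    (ht : t ∈ Icc (0 : ℝ) 1) :
    developingIntegrand D p γ t =
      (differential f p).inverse (derivWithin (f ∘ γ) (Icc 0 1) t) := by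
  have h := (hasDerivWithinAt_comp_curve (hγ.mdifferentiableWithinAt ht)
    ((H (γ t)).contMDiffAt.mdifferentiableAt (by simp))).derivWithin
    (uniqueDiffOn_Icc zero_lt_one t ht)
  rw [h, developingIntegrand, parallelTransport_eq H (hc _)]
  rfl

theorem IsCurve.contDiffOn_comp (H : ∀ x, IsFlatAt D f x) {γ : ℝ → N} {p q : N}
    (hγ : IsCurve E γ p q) : ContDiffOn ℝ 1 (f ∘ γ) (Icc 0 1) := by
  have hf : ContMDiff 𝓘(ℝ, E) 𝓘(ℝ, E) 1 f := fun x =>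
    (H x).contMDiffAt.of_le ENat.LEInfty.out
  exact contMDiffOn_iff_contDiffOn.1 (hf.comp_contMDiffOn hγ.contMDiffOn)

theorem intervalIntegrable_developingIntegrand [CompleteSpace E] (H : ∀ x, IsFlatAt D f x)
    {γ : ℝ → N} {p q : N} (hc : ∀ x : N, ∃ γ : ℝ → N, IsCurve E γ x p) (hγ : IsCurve E γ p q) :
    IntervalIntegrable (developingIntegrand D p γ) MeasureTheory.volume 0 1 := by
  refine ContinuousOn.intervalIntegrable_of_Icc zero_le_one ?_
  refine ContinuousOn.congr ?_ fun t ht => developingIntegrand_eq H hc hγ ht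
  exact ((differential f p).inverse : E →L[ℝ] E).continuous.comp_continuousOn
    ((hγ.contDiffOn_comp H).continuousOn_derivWithin (uniqueDiffOn_Icc zero_lt_one) le_rfl)

theorem integral_developingIntegrand [CompleteSpace E] (H : ∀ x, IsFlatAt D f x) {γ : ℝ → N}
    {p q : N} (hc : ∀ x : N, ∃ γ : ℝ → N, IsCurve E γ x p) (hγ : IsCurve E γ p q) :
    (∫ t in (0 : ℝ)..1, developingIntegrand D p γ t) =
      (differential f p).inverse (f q - f p) := by
  have hcd := hγ.contDiffOn_comp H
  let L : E →L[ℝ] E := (differential f p).inverse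
  have h1 : (∫ t in (0 : ℝ)..1, developingIntegrand D p γ t) =
      ∫ t in (0 : ℝ)..1, L (derivWithin (f ∘ γ) (Icc 0 1) t) := by
    refine intervalIntegral.integral_congr fun t ht => ?_
    rw [uIcc_of_le zero_le_one] at ht
    exact developingIntegrand_eq H hc hγ ht
  have hint : IntervalIntegrable (derivWithin (f ∘ γ) (Icc 0 1)) MeasureTheory.volume 0 1 :=
    (hcd.continuousOn_derivWithin (uniqueDiffOn_Icc zero_lt_one)
      le_rfl).intervalIntegrable_of_Icc zero_le_one
  rw [h1, L.intervalIntegral_comp_comm hint,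
    intervalIntegral.integral_derivWithin_Icc_of_contDiffOn_Icc hcd zero_le_one]
  simp only [Function.comp_apply, hγ.source, hγ.target]
  rfl

theorem dev_eq [CompleteSpace E] (H : ∀ x, IsFlatAt D f x)
    (hc : ∀ x y : N, ∃ γ : ℝ → N, IsCurve E γ x y) (p q : N) :
    dev D p q = (differential f p).inverse (f q - f p) := by
  exact (dif_pos (hc p q)).trans
    (integral_developingIntegrand H (fun x => hc x p) (hc p q).choose_spec)

end FlatTransport

/-! ### Connecting points by curves -/

section Curves

variable {E : Type*} [NormedAddCommGroup E] [NormedSpace ℝ E]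
  {N : Type*} [TopologicalSpace N] [ChartedSpace E N]

/-- `p` and `q` are joined by a `C¹` curve `ℝ → N` that rests at `p` for `t ≤ 0` and at `q` for
`1 ≤ t`. Resting at the ends makes the relation transitive, since concatenations stay `C¹`. -/
def JoinedByRestingCurve (E : Type*) [NormedAddCommGroup E] [NormedSpace ℝ E]
    {N : Type*} [TopologicalSpace N] [ChartedSpace E N] (p q : N) : Prop :=
  ∃ γ : ℝ → N, ContMDiff 𝓘(ℝ, ℝ) 𝓘(ℝ, E) 1 γ ∧ (∀ t ≤ 0, γ t = p) ∧ ∀ t, 1 ≤ t → γ t = q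

theorem JoinedByRestingCurve.symm {p q : N} (h : JoinedByRestingCurve E p q) :
    JoinedByRestingCurve E q p := by
  obtain ⟨γ, hγ, h0, h1⟩ := h
  refine ⟨fun t => γ (1 - t), hγ.comp ?_, fun t ht => h1 _ (by linarith),
    fun t ht => h0 _ (by linarith)⟩
  exact (contDiff_const.sub contDiff_id).contMDiff

theorem JoinedByRestingCurve.trans {p q r : N} (h : JoinedByRestingCurve E p q)
    (h' : JoinedByRestingCurve E q r) : JoinedByRestingCurve E p r := by
  obtain ⟨γ, hγ, h0, h1⟩ := h
  obtain ⟨γ', hγ', h0', h1'⟩ := h'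
  -- the curve rests at `q` for `1/3 ≤ t ≤ 2/3`
  refine ⟨fun t => if t ≤ 1 / 2 then γ (3 * t) else γ' (3 * t - 2), fun t => ?_,
    fun t ht => ?_, fun t ht => ?_⟩
  · have hs : ContMDiff 𝓘(ℝ, ℝ) 𝓘(ℝ, ℝ) 1 fun t : ℝ => 3 * t :=
      (contDiff_const.mul contDiff_id).contMDiff
    have hs' : ContMDiff 𝓘(ℝ, ℝ) 𝓘(ℝ, ℝ) 1 fun t : ℝ => 3 * t - 2 :=
      ((contDiff_const.mul contDiff_id).sub contDiff_const).contMDiff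
    rcases lt_or_ge t (2 / 3) with ht | ht
    · refine (hγ.comp hs).contMDiffAt.congr_of_eventuallyEq ?_
      filter_upwards [eventually_lt_nhds ht] with s hs
      by_cases h : s ≤ 1 / 2
      · simp only [if_pos h, Function.comp_apply]
      · rw [if_neg h, h0' _ (by linarith), Function.comp_apply, h1 _ (by linarith)]
    · refine (hγ'.comp hs').contMDiffAt.congr_of_eventuallyEq ?_
      filter_upwards [eventually_gt_nhds (show 1 / 3 < t by linarith)] with s hs
      by_cases h : s ≤ 1 / 2
      · rw [if_pos h, h1 _ (by linarith), Function.comp_apply, h0' _ (by linarith)]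
      · simp only [if_neg h, Function.comp_apply]
  · simp only [if_pos (show t ≤ 1 / 2 by linarith), h0 (3 * t) (by linarith)]
  · simp only [if_neg (show ¬t ≤ 1 / 2 by linarith), h1' (3 * t - 2) (by linarith)]

theorem eventually_joinedByRestingCurve [IsManifold 𝓘(ℝ, E) ∞ N] (x : N) :
    ∀ᶠ y in 𝓝 x, JoinedByRestingCurve E x y := by
  let c := chartAt E x
  have hx : x ∈ c.source := mem_chart_source E x
  obtain ⟨r, hr, hball⟩ := Metric.isOpen_iff.1 c.open_target (c x) (mem_chart_target E x)
  filter_upwards [c.open_source.mem_nhds hx,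
    (c.continuousAt hx).preimage_mem_nhds (Metric.ball_mem_nhds _ hr)] with y hy hyr
  let l : ℝ → E := fun t => c x + Real.smoothTransition t • (c y - c x)
  have hl : ∀ t, l t ∈ c.target := fun t => hball <|
    (convex_ball (c x) r).add_smul_sub_mem (Metric.mem_ball_self hr) hyr
      ⟨Real.smoothTransition.nonneg t, Real.smoothTransition.le_one t⟩
  have hls : ContDiff ℝ 1 l :=
    contDiff_const.add ((Real.smoothTransition.contDiff (n := 1)).smul contDiff_const)
  have hcs : ContMDiffOn 𝓘(ℝ, E) 𝓘(ℝ, E) 1 c.symm c.target :=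
    (contMDiffOn_chart_symm (I := 𝓘(ℝ, E)) (n := ∞)).of_le ENat.LEInfty.out
  refine ⟨c.symm ∘ l, hcs.comp_contMDiff hls.contMDiff hl, fun t ht => ?_, fun t ht => ?_⟩
  · simp [l, Real.smoothTransition.zero_of_nonpos ht, hx]
  · simp [l, Real.smoothTransition.one_of_one_le ht, hy]

theorem exists_isCurve [IsManifold 𝓘(ℝ, E) ∞ N] [ConnectedSpace N] (p q : N) :
    ∃ γ : ℝ → N, IsCurve E γ p q := by
  have : Std.Symm (JoinedByRestingCurve E (N := N)) := ⟨fun _ _ h => h.symm⟩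
  obtain ⟨γ, hγ, h0, h1⟩ := PreconnectedSpace.induction₂ (JoinedByRestingCurve E (N := N))
    eventually_joinedByRestingCurve ⟨fun _ _ _ h h' => h.trans h'⟩ p q
  exact ⟨γ, hγ.contMDiffOn, h0 0 le_rfl, h1 1 le_rfl⟩

end Curves

/-! ### Deck transformations and monodromy -/

section Deck

theorem apply_deck {N M : Type*} [TopologicalSpace N] {π : N → M} {φ : N ≃ₜ N}
    (hφ : φ ∈ deckGroup π) (y : N) : π (φ y) = π y :=
  congrFun (show π ∘ φ = π from hφ) y

variable {E : Type*} [NormedAddCommGroup E] [NormedSpace ℝ E]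
  {M : Type*} [TopologicalSpace M] [ChartedSpace E M] {N : Type*} [TopologicalSpace N]

theorem IsDevelopingMap.comp_deck {π : N → M} {f : N → E} (hf : IsDevelopingMap π f)
    {φ : N ≃ₜ N} (hφ : φ ∈ deckGroup π) : IsDevelopingMap π (f ∘ φ) := by
  intro y
  obtain ⟨A, hA⟩ := hf (φ y)
  refine ⟨A, ?_⟩
  filter_upwards [φ.continuous.continuousAt.eventually hA] with z hz
  rw [Function.comp_apply, hz, apply_deck hφ, apply_deck hφ]

variable [ChartedSpace E N]

/-- Near each point a deck transformation is `π` followed by a local inverse of `π`. -/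
theorem contMDiff_deck {π : N → M} (hπ : IsLocalDiffeomorph 𝓘(ℝ, E) 𝓘(ℝ, E) ∞ π) {φ : N ≃ₜ N}
    (hφ : φ ∈ deckGroup π) : ContMDiff 𝓘(ℝ, E) 𝓘(ℝ, E) ∞ φ := by
  intro y
  have h1 : ContMDiffAt 𝓘(ℝ, E) 𝓘(ℝ, E) ∞ (hπ (φ y)).localInverse (π y) := by
    rw [← apply_deck hφ y]
    exact (hπ (φ y)).localInverse_contMDiffAt
  refine (h1.comp y (hπ y).contMDiffAt).congr_of_eventuallyEq ?_
  filter_upwards [φ.continuous.continuousAt.eventually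
    (hπ (φ y)).localInverse_eventuallyEq_left] with z hz
  rw [Function.comp_apply, ← apply_deck hφ z]
  exact hz.symm

variable [IsManifold 𝓘(ℝ, E) ∞ N]

theorem monodromyMap_apply (D : Connection E N) (p : N) (φ : N ≃ₜ N)
    (v : TangentSpace 𝓘(ℝ, E) p) :
    monodromyMap D p φ v = linearPart D p φ v + translationPart D p φ := rfl

theorem monodromyMap_mul {D : Connection E N} {p : N} {φ ψ : N ≃ₜ N}
    (hA : linearPart D p (φ * ψ) = linearPart D p φ ∘L linearPart D p ψ)
    (hb : translationPart D p (φ * ψ) =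
      linearPart D p φ (translationPart D p ψ) + translationPart D p φ) :
    monodromyMap D p (φ * ψ) = (monodromyMap D p φ).comp (monodromyMap D p ψ) := by
  ext v
  rw [AffineMap.comp_apply, monodromyMap_apply, monodromyMap_apply, monodromyMap_apply, hA, hb,
    map_add, ContinuousLinearMap.comp_apply, add_assoc]

variable [CompleteSpace E] {D : Connection E N} {f : N → E}

/-- If flat coordinates `f` satisfy `f ∘ φ = C ∘ f`, then `A_φ` is the linear part of `C`, read in
`T_p N` through `df_p`. -/
theorem linearPart_eq [ConnectedSpace N] (H : ∀ x, IsFlatAt D f x) {φ : N ≃ₜ N}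
    (hφ : ContMDiff 𝓘(ℝ, E) 𝓘(ℝ, E) ∞ φ) {C : E ≃ᴬ[ℝ] E} (hC : ∀ y, f (φ y) = C (f y))
    (p : N) (v : TangentSpace 𝓘(ℝ, E) p) :
    linearPart D p φ v = (differential f p).inverse
      (C.toContinuousAffineMap.contLinear (differential f p v)) := by
  have h1 := mfderiv_comp p ((H (φ p)).contMDiffAt.mdifferentiableAt (by simp))
    (hφ.contMDiffAt.mdifferentiableAt (by simp))
  have h2 := mfderiv_comp p (hasMFDerivAt_continuousAffineEquiv C (f p)).mdifferentiableAt
    ((H p).contMDiffAt.mdifferentiableAt (by simp))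
  rw [show f ∘ φ = C ∘ f from funext hC, h2,
    (hasMFDerivAt_continuousAffineEquiv C (f p)).mfderiv] at h1
  have h3 : differential f (φ p) (mfderiv 𝓘(ℝ, E) 𝓘(ℝ, E) φ p v) =
      C.toContinuousAffineMap.contLinear (differential f p v) :=
    (DFunLike.congr_fun h1 v).symm
  rw [← h3, linearPart, parallelTransport_eq H (exists_isCurve _ _)]
  rfl

theorem dev_apply_eq_monodromyMap [ConnectedSpace N] (H : ∀ x, IsFlatAt D f x) {φ : N ≃ₜ N}
    (hφ : ContMDiff 𝓘(ℝ, E) 𝓘(ℝ, E) ∞ φ) {C : E ≃ᴬ[ℝ] E} (hC : ∀ y, f (φ y) = C (f y))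
    (p q : N) : dev D p (φ q) = monodromyMap D p φ (dev D p q) := by
  have hsub : f (φ q) - f p =
      C.toContinuousAffineMap.contLinear (f q - f p) + (f (φ p) - f p) := by
    have := C.toContinuousAffineMap.contLinear_map_vsub (f q) (f p)
    simp only [vsub_eq_sub] at this
    rw [this, hC, hC]
    simp
  rw [monodromyMap_apply, linearPart_eq H hφ hC, translationPart, dev_eq H exists_isCurve,
    dev_eq H exists_isCurve, dev_eq H exists_isCurve,
    (H p).differential_isInvertible.self_apply_inverse, ← map_add, hsub]

theorem linearPart_mul [ConnectedSpace N] (H : ∀ x, IsFlatAt D f x) {φ ψ : N ≃ₜ N}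
    (hφ : ContMDiff 𝓘(ℝ, E) 𝓘(ℝ, E) ∞ φ) (hψ : ContMDiff 𝓘(ℝ, E) 𝓘(ℝ, E) ∞ ψ)
    {B C : E ≃ᴬ[ℝ] E} (hB : ∀ y, f (φ y) = B (f y)) (hC : ∀ y, f (ψ y) = C (f y)) (p : N) :
    linearPart D p (φ * ψ) = linearPart D p φ ∘L linearPart D p ψ := by
  have hBC : ∀ y, f ((φ * ψ) y) = (C.trans B) (f y) := fun y => by
    rw [ContinuousAffineEquiv.trans_apply, ← hC, ← hB]
    rfl
  have hφψ : ContMDiff 𝓘(ℝ, E) 𝓘(ℝ, E) ∞ (φ * ψ) := hφ.comp hψ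
  ext v
  rw [ContinuousLinearMap.comp_apply, linearPart_eq H hφψ hBC, linearPart_eq H hφ hB,
    linearPart_eq H hψ hC, (H p).differential_isInvertible.self_apply_inverse]
  rfl

theorem monodromyMap_one [ConnectedSpace N] (H : ∀ x, IsFlatAt D f x) (p : N) :
    monodromyMap D p 1 = AffineMap.id ℝ (TangentSpace 𝓘(ℝ, E) p) := by
  ext v
  have h1 := linearPart_eq H (φ := 1) contMDiff_id (C := .refl ℝ E) (fun _ => rfl) p v
  have h2 : translationPart D p 1 = 0 := by
    rw [translationPart, dev_eq H exists_isCurve]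
    change (differential f p).inverse (f p - f p) = 0
    rw [sub_self, map_zero]
  rw [monodromyMap_apply, h1, h2, add_zero]
  exact (H p).differential_isInvertible.inverse_apply_self v

/-- A multiplicative family of affine self-maps indexed by a group consists of affine
automorphisms. -/
theorem exists_monoidHom_affineEquiv {G P V : Type*} [Group G] [AddCommGroup V] [Module ℝ V]
    [AddTorsor V P] (m : G → P →ᵃ[ℝ] P) (h1 : m 1 = AffineMap.id ℝ P)
    (hmul : ∀ g h, m (g * h) = (m g).comp (m h)) :
    ∃ m' : G →* (P ≃ᵃ[ℝ] P), ∀ g, (m' g).toAffineMap = m g := by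
  let m₀ : G →* (P →ᵃ[ℝ] P) := { toFun := m, map_one' := h1, map_mul' := hmul }
  exact ⟨AffineEquiv.equivUnitsAffineMap.symm.toMonoidHom.comp m₀.toHomUnits, fun g => rfl⟩

end Deck

end AffineMonodromy

end

open AffineMonodromy

theorem mainTheorem2
    {E : Type*} [NormedAddCommGroup E] [NormedSpace ℝ E] [FiniteDimensional ℝ E]
    {M : Type*} [TopologicalSpace M] [T2Space M] [ConnectedSpace M] [ChartedSpace E M]
    [HasGroupoid M (AffineMonodromy.affineGroupoid E)]
    {M' : Type*} [TopologicalSpace M'] [SimplyConnectedSpace M'] [ChartedSpace E M']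
    [IsManifold 𝓘(ℝ, E) ∞ M']
    (π : M' → M) (hcov : IsCoveringMap π) (hπ : IsLocalDiffeomorph 𝓘(ℝ, E) 𝓘(ℝ, E) ∞ π)
    (D : AffineMonodromy.Connection E M')
    (hD : D = AffineMonodromy.pullbackConnection π hπ (AffineMonodromy.affineConnection M))
    (p : M') :
    -- parallel transport on the universal cover is well defined and independent of the curve
    (∀ q q' : M', AffineMonodromy.IsParallelTransport D q q'
      (AffineMonodromy.parallelTransport D q q')) ∧
    -- the developing map is well defined and independent of the curve
    (∀ q : M', (∃ γ : ℝ → M', AffineMonodromy.IsCurve E γ p q) ∧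
      ∀ γ : ℝ → M', AffineMonodromy.IsCurve E γ p q →
        IntervalIntegrable (AffineMonodromy.developingIntegrand D p γ) MeasureTheory.volume 0 1 ∧
        AffineMonodromy.dev D p q =
          (∫ t in (0 : ℝ)..1, AffineMonodromy.developingIntegrand D p γ t : E)) ∧
    -- deck transformations are smooth, and `dev ∘ φ = m_φ ∘ dev`
    (∀ φ ∈ AffineMonodromy.deckGroup π, ContMDiff 𝓘(ℝ, E) 𝓘(ℝ, E) ∞ φ ∧
      ∀ q : M', AffineMonodromy.dev D p (φ q) =
        AffineMonodromy.monodromyMap D p φ (AffineMonodromy.dev D p q)) ∧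
    -- `φ ↦ m_φ` is a group homomorphism into the group of affine transformations of `T_p M'`
    (∃ m : AffineMonodromy.deckGroup π →*
        (TangentSpace 𝓘(ℝ, E) p ≃ᵃ[ℝ] TangentSpace 𝓘(ℝ, E) p),
      ∀ φ : AffineMonodromy.deckGroup π,
        (m φ).toAffineMap = AffineMonodromy.monodromyMap D p φ) ∧
    (∀ φ ∈ AffineMonodromy.deckGroup π, ∀ ψ ∈ AffineMonodromy.deckGroup π,
      AffineMonodromy.monodromyMap D p (φ * ψ) =
        (AffineMonodromy.monodromyMap D p φ).comp (AffineMonodromy.monodromyMap D p ψ) ∧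
      AffineMonodromy.linearPart D p (φ * ψ) =
        AffineMonodromy.linearPart D p φ ∘L AffineMonodromy.linearPart D p ψ ∧
      AffineMonodromy.translationPart D p (φ * ψ) =
        AffineMonodromy.linearPart D p φ (AffineMonodromy.translationPart D p ψ) +
          AffineMonodromy.translationPart D p φ) := by
  have := FiniteDimensional.complete ℝ E
  have : LocallyPathConnectedSpace M' := ChartedSpace.locallyPathConnectedSpace E M'
  obtain ⟨f, hf⟩ := exists_isDevelopingMap (E := E) hcov.continuous
  have H : ∀ x, IsFlatAt D f x := fun x => hD ▸ hf.isFlatAt hπ x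
  have hcurve : ∀ x y : M', ∃ γ : ℝ → M', IsCurve E γ x y := exists_isCurve
  have hsmooth := fun φ hφ => contMDiff_deck (φ := φ) hπ hφ
  have hC : ∀ φ ∈ deckGroup π, ∃ C : E ≃ᴬ[ℝ] E, ∀ y, f (φ y) = C (f y) := fun φ hφ =>
    hf.exists_eq_comp (hf.comp_deck hφ) hcov.isLocalHomeomorph
  have hdev : ∀ φ ∈ deckGroup π, ∀ q, dev D p (φ q) = monodromyMap D p φ (dev D p q) := by
    intro φ hφ q
    obtain ⟨C, hC⟩ := hC φ hφ
    exact dev_apply_eq_monodromyMap H (hsmooth φ hφ) hC p q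
  have hlin : ∀ φ ∈ deckGroup π, ∀ ψ ∈ deckGroup π,
      linearPart D p (φ * ψ) = linearPart D p φ ∘L linearPart D p ψ := by
    intro φ hφ ψ hψ
    obtain ⟨B, hB⟩ := hC φ hφ
    obtain ⟨C, hC⟩ := hC ψ hψ
    exact linearPart_mul H (hsmooth φ hφ) (hsmooth ψ hψ) hB hC p
  -- the case `q = ψ p` of `dev ∘ φ = m_φ ∘ dev`
  have htrans : ∀ φ ∈ deckGroup π, ∀ ψ ∈ deckGroup π, translationPart D p (φ * ψ) =
      linearPart D p φ (translationPart D p ψ) + translationPart D p φ :=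
    fun φ hφ ψ _ => hdev φ hφ (ψ p)
  refine ⟨isParallelTransport_parallelTransport H, fun q => ⟨hcurve p q, fun γ hγ =>
    ⟨intervalIntegrable_developingIntegrand H (fun x => hcurve x p) hγ, ?_⟩⟩,
    fun φ hφ => ⟨hsmooth φ hφ, hdev φ hφ⟩, ?_, fun φ hφ ψ hψ =>
    ⟨monodromyMap_mul (hlin φ hφ ψ hψ) (htrans φ hφ ψ hψ), hlin φ hφ ψ hψ, htrans φ hφ ψ hψ⟩⟩
  · exact (dev_eq H hcurve p q).trans
      (integral_developingIntegrand H (fun x => hcurve x p) hγ).symm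
  · exact exists_monoidHom_affineEquiv (fun φ : deckGroup π => monodromyMap D p φ)
      (monodromyMap_one H p) fun φ ψ => monodromyMap_mul (hlin φ φ.2 ψ ψ.2) (htrans φ φ.2 ψ ψ.2)
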